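/- Every $x\in(0,1]$ has a unique Lüroth expansion $x=\frac1{d_1}+\frac1{s_1d_2}+\frac1{s_1s_2d_3}+\cdots$ with integers $d_j=d_j(x)\ge 2$ and $s_j=d_j(d_j-1)$. Let $D_n=d_n(x)$, $n\ge1$, regarded as random variables on $[0,1]$ with Lebesgue measure $P$. For a real number $\alpha<1$ put $w_k=k^{-\alpha}$, $W_n=\sum_{k=1}^n w_k$, $a_{k,n}=w_k/W_n$ $(1\le k\le n)$ and $$D_n^{(\alpha,1)}=\sum_{k=1}^n a_{k,n}D_k .$$ Let $(F_n)_{n\ge1}$ be distribution functions on $[0,1]$ with $F_n(0)=0$ which generate the Lüroth digits, i.e. for all integers $n,h\ge1$ $$F_n\left(\tfrac1h\right)-F_n\left(\tfrac1{h+1}\right)=\frac1{h(h+1)}$$ (the probability that $D_{n+1}-1=h$). Let $(\lambda_n)_{n\ge1}$ be positive numbers with $0<\liminf_n\lambda_n\le\limsup_n\lambda_n<\infty$ such that $$\lim_{t\to0^+}\sup_{n\ge1}\left|\frac{F_n(t)}t-\lambda_n\right|=0,\qquad \lim_{t\to0^+}\sup_{n\ge1}\int_0^t\frac1u\left|\frac{F_n(u)}u-\lambda_n\right|du=0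 .$$ Let $(\rho_n)_{n\ge1}$ be real numbers with $\rho_n\log n\to+\infty$, such that $$\limsup_{n\to\infty}\frac{\sum_{k=1}^n\lambda_ka_{k,n}\left|\log(\lambda_ka_{k,n})\right|}{\rho_n\log n}<\infty,$$ the finite limit $$-\ell:=\lim_{n\to\infty}\frac{\sum_{k=1}^n\lambda_ka_{k,n}\log(\lambda_ka_{k,n})}{\rho_n\log n}$$ exists, and the sequence $n\mapsto\sum_{k=1}^n\lambda_ka_{k,n}$ is bounded. Then $$\frac1{\rho_n\log n}\,D_n^{(\alpha,1)}\longrightarrow\ell\qquad\text{in probability as }n\to\infty .$$ -/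

import Mathlib

open Filter Topology MeasureTheory

noncomputable section

/-- The probability space `([0,1], Borel, Lebesgue)`, carried by the real line. -/
def unitLebesgue : Measure ℝ := volume.restrict (Set.Icc (0 : ℝ) 1)

/-- First Lüroth digit of `x ∈ (0,1]`: the integer `d ≥ 2` with `1 / d < x ≤ 1 / (d - 1)`. -/
def lurothFirst (x : ℝ) : ℕ := ⌊1 / x⌋₊ + 1

/-- The remainder `x'` in `x = 1 / d + x' / (d (d - 1))`, where `d` is the first digit of `x`. -/
def lurothMap (x : ℝ) : ℝ :=
  (lurothFirst x : ℝ) * ((lurothFirst x : ℝ) - 1) * (x - 1 / (lurothFirst x : ℝ))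

/-- The `n`-th digit `D_n` (`n ≥ 1`) of the Lüroth series
`x = 1 / d₁ + 1 / (s₁ d₂) + 1 / (s₁ s₂ d₃) + ⋯`, `s_j = d_j (d_j - 1)`. -/
def lurothDigit (n : ℕ) (x : ℝ) : ℕ := lurothFirst (lurothMap^[n - 1] x)

/-- `w_k = 1 / k ^ α`. -/
def meanWeight (α : ℝ) (k : ℕ) : ℝ := 1 / (k : ℝ) ^ α

/-- `W_n = w_1 + ⋯ + w_n`. -/
def meanTotal (α : ℝ) (n : ℕ) : ℝ := ∑ k ∈ Finset.Icc 1 n, meanWeight α k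

/-- The `r`-iterated `α`-weighted means of a real sequence. -/
def iteratedMean (α : ℝ) (X : ℕ → ℝ) : ℕ → ℕ → ℝ
  | 0, n => X n
  | r + 1, n =>
      (∑ k ∈ Finset.Icc 1 n, meanWeight α k * iteratedMean α X r k) / meanTotal α n

/-- The random variables `D_n^{(α,r)}`. -/
def lurothMean (α : ℝ) (r n : ℕ) (x : ℝ) : ℝ :=
  iteratedMean α (fun k => (lurothDigit k x : ℝ)) r n

/-- Distribution functions on `[0,1]` vanishing at `0`. Only the values on `[0,1]` matter. -/
structure IsUnitDistFun (F : ℝ → ℝ) : Prop where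
  mono : MonotoneOn F (Set.Icc 0 1)
  right_cont : ∀ t ∈ Set.Ico (0 : ℝ) 1, ContinuousWithinAt F (Set.Ici t) t
  at_zero : F 0 = 0
  at_one : F 1 = 1

/-- `F_n(t) / t` is close to `c_n` near `0`, uniformly in `n ≥ 1`, for positive numbers `c_n` with
`0 < liminf c_n ≤ limsup c_n < ∞`. -/
structure UniformSlope (F : ℕ → ℝ → ℝ) (c : ℕ → ℝ) : Prop where
  pos : ∀ n, 1 ≤ n → 0 < c n
  liminf_pos : 0 < liminf (fun n => (c n : EReal)) atTop
  limsup_lt_top : limsup (fun n => (c n : EReal)) atTop < ⊤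
  tendsto_sup : Tendsto (fun t : ℝ => ⨆ n ∈ Set.Ici 1, ENNReal.ofReal |F n t / t - c n|)
    (𝓝[>] 0) (𝓝 0)

/-- Uniform integrability near `0` of the functions `u ↦ (F_n(u) / u - c_n) / u`, `n ≥ 1`. -/
def UniformSlopeIntegrable (F : ℕ → ℝ → ℝ) (c : ℕ → ℝ) : Prop :=
  Tendsto (fun t : ℝ => ⨆ n ∈ Set.Ici 1,
      ∫⁻ u in Set.Ioo 0 t, ENNReal.ofReal (1 / u * |F n u / u - c n|))
    (𝓝[>] 0) (𝓝 0)

/-- The conditions on an array `a k n` (`1 ≤ k ≤ n`), the normalisation `ρ` and the constant `ℓ`. -/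
structure ArrayConditions (c : ℕ → ℝ) (a : ℕ → ℕ → ℝ) (ρ : ℕ → ℝ) (ℓ : ℝ) : Prop where
  pos : ∀ n k, 1 ≤ k → k ≤ n → 0 < a k n
  norm_tendsto : Tendsto (fun n : ℕ => ρ n * Real.log n) atTop atTop
  limsup_lt_top : limsup (fun n : ℕ => (((∑ k ∈ Finset.Icc 1 n,
      c k * a k n * |Real.log (c k * a k n)|) / (ρ n * Real.log n) : ℝ) : EReal)) atTop < ⊤
  tendsto_neg : Tendsto (fun n : ℕ => (∑ k ∈ Finset.Icc 1 n,
      c k * a k n * Real.log (c k * a k n)) / (ρ n * Real.log n)) atTop (𝓝 (-ℓ))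
  bounded : ∃ M : ℝ, ∀ n, 1 ≤ n → ∑ k ∈ Finset.Icc 1 n, c k * a k n ≤ M

/-- `F_n` generates the Lüroth digits: `F_n(1 / h) - F_n(1 / (h + 1))` is the probability
`1 / (h (h + 1))` with which `D_{n+1} - 1` takes the value `h`. -/
def GeneratesLuroth (F : ℕ → ℝ → ℝ) : Prop :=
  ∀ n h : ℕ, 1 ≤ n → 1 ≤ h →
    F n (1 / (h : ℝ)) - F n (1 / ((h : ℝ) + 1)) = 1 / ((h : ℝ) * ((h : ℝ) + 1))

end

open ProbabilityTheory

/-! Generating the Lüroth digits forces `F n (1/h) = 1/h`, hence every slope is `1`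
(`GeneratesLuroth.slope_eq_one`), and the claim becomes a weak law for convex combinations of
identically distributed, pairwise independent digits with infinite mean. With `b = ρ n * log n`,
truncate the digit `D_k` at `b / a_k`. The truncated sum has mean `log b - ∑ a_k log a_k + O(1)` and
variance at most `2b`, and differs from the true sum with probability at most `2/b`. Chebyshev's
inequality (`unitLebesgue_weighted_sum_deviation_le`) then gives deviations of order `b` probability
`O(1/b)`; after division by `b` the centre tends to `ℓ`, because `log b / b → 0`. -/

theorem unitLebesgue_eq_restrict_Ioc : unitLebesgue = volume.restrict (Set.Ioc (0 : ℝ) 1) :=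
  Measure.restrict_congr_set Ioc_ae_eq_Icc.symm

instance isProbabilityMeasure_unitLebesgue : IsProbabilityMeasure unitLebesgue :=
  ⟨by simp [unitLebesgue]⟩

theorem ae_mem_Ioc_unitLebesgue : ∀ᵐ x ∂unitLebesgue, x ∈ Set.Ioc (0 : ℝ) 1 := by
  rw [unitLebesgue_eq_restrict_Ioc]
  exact ae_restrict_mem measurableSet_Ioc

/-! ### The Lüroth map: independence and common law of the digits. -/

theorem measurable_lurothFirst : Measurable lurothFirst := by
  unfold lurothFirst
  exact (Nat.measurable_floor.comp (by fun_prop)).add_const 1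

theorem measurable_lurothMap : Measurable lurothMap := by
  have h : Measurable fun x : ℝ => (lurothFirst x : ℝ) :=
    (measurable_from_top (f := fun n : ℕ => (n : ℝ))).comp measurable_lurothFirst
  unfold lurothMap
  fun_prop

theorem measurable_lurothDigit (n : ℕ) : Measurable (lurothDigit n) :=
  measurable_lurothFirst.comp (measurable_lurothMap.iterate _)

theorem two_le_lurothFirst {x : ℝ} (hx : x ∈ Set.Ioc (0 : ℝ) 1) : 2 ≤ lurothFirst x := by
  have : 1 ≤ ⌊1 / x⌋₊ := Nat.le_floor (by simpa using (one_le_div hx.1).2 hx.2)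
  unfold lurothFirst
  lia

theorem lurothFirst_eq_iff {x : ℝ} (hx : 0 < x) {d : ℕ} (hd : 2 ≤ d) :
    lurothFirst x = d ↔ ((d : ℝ) - 1) * x ≤ 1 ∧ 1 < d * x := by
  obtain ⟨e, rfl⟩ : ∃ e, d = e + 1 := ⟨d - 1, by lia⟩
  have he : e ≠ 0 := by lia
  simp only [lurothFirst, Nat.add_right_cancel_iff, Nat.floor_eq_iff' he]
  rw [le_div_iff₀ hx, div_lt_iff₀ hx]
  push_cast
  simp

/-- On each fundamental interval `(1 / d, 1 / (d - 1)]` the Lüroth map is affine onto `(0,1]`. -/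
theorem unitLebesgue_fiber_inter_preimage {d : ℕ} (hd : 2 ≤ d) {A : Set ℝ}
    (hA : MeasurableSet A) :
    unitLebesgue (lurothFirst ⁻¹' {d} ∩ lurothMap ⁻¹' A) =
      ENNReal.ofReal (1 / ((d : ℝ) * (d - 1))) * unitLebesgue A := by
  have hd' : (2 : ℝ) ≤ d := by exact_mod_cast hd
  have hs : (0 : ℝ) < d * (d - 1) := mul_pos (by linarith) (by linarith)
  rw [unitLebesgue_eq_restrict_Ioc, Measure.restrict_apply hA,
    Measure.restrict_apply (((measurable_lurothFirst (measurableSet_singleton d))).inter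
      (measurable_lurothMap hA))]
  -- Written as a scaling followed by a translation, the affine branch has a preimage whose volume
  -- is computed by invariance.
  have hset : lurothFirst ⁻¹' {d} ∩ lurothMap ⁻¹' A ∩ Set.Ioc 0 1 =
      ((d : ℝ) * (d - 1) * ·) ⁻¹' ((· + (1 - (d : ℝ))) ⁻¹' (A ∩ Set.Ioc 0 1)) := by
    have hg : ∀ x : ℝ, (d : ℝ) * (d - 1) * x + (1 - d) = (d - 1) * (d * x - 1) := fun x => by ring
    ext x
    simp only [Set.mem_inter_iff, Set.mem_preimage, Set.mem_singleton_iff, Set.mem_Ioc]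
    constructor
    · rintro ⟨⟨h1, h2⟩, h3, h4⟩
      have hT : lurothMap x = (d : ℝ) * (d - 1) * x + (1 - d) := by
        rw [lurothMap, h1]; field_simp; ring
      obtain ⟨h5, h6⟩ := (lurothFirst_eq_iff h3 hd).1 h1
      rw [← hT]
      refine ⟨h2, ?_, ?_⟩
      · rw [hT, hg]; exact mul_pos (by linarith) (by linarith)
      · rw [hT]; nlinarith
    · rintro ⟨h2, h3, h4⟩
      have h5 : 0 < (d : ℝ) * x - 1 := by
        rw [hg] at h3; exact (mul_pos_iff_of_pos_left (by linarith)).1 h3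
      have hx : 0 < x := (mul_pos_iff_of_pos_left (b := x) (by linarith : (0 : ℝ) < d)).1 (by linarith)
      have h6 : ((d : ℝ) - 1) * x ≤ 1 :=
        le_of_mul_le_mul_left (by linarith : (d : ℝ) * ((d - 1) * x) ≤ d * 1) (by linarith)
      have h1 := (lurothFirst_eq_iff hx hd).2 ⟨h6, by linarith⟩
      have hT : lurothMap x = (d : ℝ) * (d - 1) * x + (1 - d) := by
        rw [lurothMap, h1]; field_simp; ring
      rw [hT]
      exact ⟨⟨h1, h2⟩, hx, by nlinarith⟩
  rw [hset, Real.volume_preimage_mul_left hs.ne', measure_preimage_add_right,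
    abs_of_pos (inv_pos.2 hs), one_div]

theorem unitLebesgue_fiber {d : ℕ} (hd : 2 ≤ d) :
    unitLebesgue (lurothFirst ⁻¹' {d}) = ENNReal.ofReal (1 / ((d : ℝ) * (d - 1))) := by
  simpa using unitLebesgue_fiber_inter_preimage hd MeasurableSet.univ

/-- Null but not always empty: `1 / 0 = 0` gives `x = 0` the digit `1`. -/
theorem unitLebesgue_fiber_of_lt_two {d : ℕ} (hd : d < 2) :
    unitLebesgue (lurothFirst ⁻¹' {d}) = 0 := by
  rw [← compl_compl (lurothFirst ⁻¹' {d})]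
  refine mem_ae_iff.1 ?_
  filter_upwards [ae_mem_Ioc_unitLebesgue] with x hx h
  have := two_le_lurothFirst hx
  simp only [Set.mem_preimage, Set.mem_singleton_iff] at h
  lia

/-- One product formula with two uses: total mass yields invariance of the measure, and evaluation
on a set yields independence of the first digit from the remainder. -/
theorem map_lurothFirst_restrict {A : Set ℝ} (hA : MeasurableSet A) :
    (unitLebesgue.restrict (lurothMap ⁻¹' A)).map lurothFirst =
      unitLebesgue A • unitLebesgue.map lurothFirst := by
  refine Measure.ext_of_singleton fun d => ?_
  have hm := measurable_lurothFirst (measurableSet_singleton d)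
  rw [Measure.map_apply measurable_lurothFirst (measurableSet_singleton d), Measure.smul_apply,
    Measure.map_apply measurable_lurothFirst (measurableSet_singleton d),
    Measure.restrict_apply hm, smul_eq_mul]
  rcases lt_or_ge d 2 with hd | hd
  · rw [unitLebesgue_fiber_of_lt_two hd, mul_zero]
    exact measure_mono_null Set.inter_subset_left (unitLebesgue_fiber_of_lt_two hd)
  · rw [unitLebesgue_fiber_inter_preimage hd hA, unitLebesgue_fiber hd, mul_comm]

theorem measurePreserving_lurothMap : MeasurePreserving lurothMap unitLebesgue unitLebesgue := by
  refine ⟨measurable_lurothMap, Measure.ext fun A hA => ?_⟩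
  have h := congrArg (fun ν : Measure ℕ => ν Set.univ) (map_lurothFirst_restrict hA)
  simpa [Measure.map_apply measurable_lurothFirst, Measure.map_apply measurable_lurothMap hA]
    using h

theorem indepFun_lurothFirst_lurothMap : IndepFun lurothFirst lurothMap unitLebesgue := by
  rw [indepFun_iff_measure_inter_preimage_eq_mul]
  intro s A hs hA
  have h := congrArg (fun ν : Measure ℕ => ν s) (map_lurothFirst_restrict hA)
  simp only [Measure.smul_apply, Measure.map_apply measurable_lurothFirst hs, smul_eq_mul,
    Measure.restrict_apply (measurable_lurothFirst hs)] at h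
  rw [h, measurePreserving_lurothMap.measure_preimage hA.nullMeasurableSet, mul_comm]

theorem IndepFun.comp_measurePreserving {Ω Ω' β γ : Type*} [MeasurableSpace Ω]
    [MeasurableSpace Ω'] [MeasurableSpace β] [MeasurableSpace γ] {μ : Measure Ω} {ν : Measure Ω'}
    {S : Ω → Ω'} {f : Ω' → β} {g : Ω' → γ} (h : IndepFun f g ν) (hS : MeasurePreserving S μ ν)
    (hf : Measurable f) (hg : Measurable g) : IndepFun (f ∘ S) (g ∘ S) μ := by
  rw [indepFun_iff_measure_inter_preimage_eq_mul] at h ⊢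
  intro s t hs ht
  have := h s t hs ht
  rw [← hS.measure_preimage (hf hs).nullMeasurableSet,
    ← hS.measure_preimage (hg ht).nullMeasurableSet,
    ← hS.measure_preimage ((hf hs).inter (hg ht)).nullMeasurableSet] at this
  exact this

/-- After `i - 1` iterations digit `i` is the first digit and digit `j` depends only on the
remainder. Pairwise independence suffices for additivity of variances. -/
theorem indepFun_lurothDigit_of_lt {i j : ℕ} (hi : 1 ≤ i) (hij : i < j) :
    IndepFun (lurothDigit i) (lurothDigit j) unitLebesgue := by
  have h : IndepFun lurothFirst (lurothDigit (j - i) ∘ lurothMap) unitLebesgue :=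
    indepFun_lurothFirst_lurothMap.comp measurable_id (measurable_lurothDigit (j - i))
  have h' := IndepFun.comp_measurePreserving h (measurePreserving_lurothMap.iterate (i - 1))
    measurable_lurothFirst ((measurable_lurothDigit _).comp measurable_lurothMap)
  suffices hj : lurothDigit j = (lurothDigit (j - i) ∘ lurothMap) ∘ lurothMap^[i - 1] by
    rw [hj]; exact h'
  funext x
  simp only [lurothDigit, Function.comp_apply]
  rw [← Function.iterate_succ_apply' lurothMap, ← Function.iterate_add_apply]
  congr 2
  lia

theorem indepFun_lurothDigit {i j : ℕ} (hi : 1 ≤ i) (hj : 1 ≤ j) (hij : i ≠ j) :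
    IndepFun (lurothDigit i) (lurothDigit j) unitLebesgue := by
  rcases hij.lt_or_gt with h | h
  · exact indepFun_lurothDigit_of_lt hi h
  · exact (indepFun_lurothDigit_of_lt hj h).symm

theorem map_lurothDigit (k : ℕ) :
    unitLebesgue.map (lurothDigit k) = unitLebesgue.map lurothFirst := by
  have h := (measurePreserving_lurothMap.iterate (k - 1)).map_eq
  conv_rhs => rw [← h]
  rw [Measure.map_map measurable_lurothFirst (measurable_lurothMap.iterate _)]
  rfl

/-! ### Tail and moments of a truncated digit. -/

/-- Expectation of a function of a digit that vanishes outside `{2, …, m}`. -/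
theorem integral_comp_lurothDigit (k m : ℕ) (g : ℕ → ℝ) (hg : ∀ d ∉ Finset.Icc 2 m, g d = 0) :
    ∫ x, g (lurothDigit k x) ∂unitLebesgue =
      ∑ d ∈ Finset.Icc 2 m, g d / ((d : ℝ) * (d - 1)) := by
  rw [← integral_map (f := g) (measurable_lurothDigit k).aemeasurable
    measurable_from_top.aestronglyMeasurable, map_lurothDigit,
    ← setIntegral_eq_integral_of_forall_compl_eq_zero (s := (Finset.Icc 2 m : Finset ℕ))
      (fun d hd => hg d (by simpa using hd))]
  rw [setIntegral_finset _ IntegrableOn.finset]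
  refine Finset.sum_congr rfl fun d hd => ?_
  have hd2 : 2 ≤ d := (Finset.mem_Icc.1 hd).1
  have hd' : (2 : ℝ) ≤ d := by exact_mod_cast hd2
  rw [Measure.real, Measure.map_apply measurable_lurothFirst (measurableSet_singleton d),
    unitLebesgue_fiber hd2, ENNReal.toReal_ofReal (one_div_nonneg.2
      (mul_nonneg (by linarith) (by linarith))), smul_eq_mul]
  ring

theorem unitLebesgue_lt_lurothDigit_le (k : ℕ) {r : ℝ} (hr : 2 ≤ r) :
    unitLebesgue {x | r < lurothDigit k x} ≤ ENNReal.ofReal (2 / r) := by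
  have h : unitLebesgue {x | r < lurothDigit k x} = unitLebesgue {x | r < lurothFirst x} := by
    have := congrArg (fun ν : Measure ℕ => ν {d | r < d}) (map_lurothDigit k)
    simpa [Measure.map_apply (measurable_lurothDigit k) trivial,
      Measure.map_apply measurable_lurothFirst trivial] using this
  rw [h]
  calc unitLebesgue {x | r < lurothFirst x} ≤ unitLebesgue (Set.Ioc 0 (2 / r)) := by
        refine measure_mono_ae ?_
        filter_upwards [ae_mem_Ioc_unitLebesgue] with x hx h
        refine ⟨hx.1, ?_⟩
        have h1 : r < (⌊1 / x⌋₊ : ℝ) + 1 := by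
          have h' : r < (lurothFirst x : ℝ) := h
          simpa [lurothFirst] using h'
        have h2 := Nat.floor_le (one_div_pos.2 hx.1).le
        have h3 : r / 2 ≤ 1 / x := by linarith
        rw [le_div_iff₀ hx.1] at h3
        rw [le_div_iff₀ (by linarith)]
        linarith
    _ ≤ volume (Set.Ioc 0 (2 / r)) := Measure.restrict_apply_le _ _
    _ = _ := by simp

/-- The identity on `{2, …, m}`, and `0` elsewhere. -/
def truncDigit (m d : ℕ) : ℝ := if d ∈ Finset.Icc 2 m then d else 0

theorem truncDigit_of_notMem {m d : ℕ} (h : d ∉ Finset.Icc 2 m) : truncDigit m d = 0 := if_neg h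

theorem truncDigit_of_mem {m d : ℕ} (h : d ∈ Finset.Icc 2 m) : truncDigit m d = d := if_pos h

theorem abs_truncDigit_le (m d : ℕ) : |truncDigit m d| ≤ m := by
  unfold truncDigit
  split_ifs with h
  · rw [Nat.abs_cast]; exact_mod_cast (Finset.mem_Icc.1 h).2
  · simp

theorem measurable_truncDigit_comp (m k : ℕ) :
    Measurable fun x => truncDigit m (lurothDigit k x) :=
  (measurable_from_top (f := truncDigit m)).comp (measurable_lurothDigit k)

theorem sum_Icc_two_inv_sub_one (m : ℕ) :
    ∑ d ∈ Finset.Icc 2 (m + 1), 1 / ((d : ℝ) - 1) = (harmonic m : ℝ) := by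
  induction m with
  | zero => simp
  | succ m ih =>
    rw [Finset.sum_Icc_succ_top (by lia), ih, harmonic_succ]
    push_cast
    simp

theorem integral_truncDigit (m k : ℕ) :
    ∫ x, truncDigit m (lurothDigit k x) ∂unitLebesgue = (harmonic (m - 1) : ℝ) := by
  rw [integral_comp_lurothDigit k m _ fun d hd => truncDigit_of_notMem hd]
  rcases m with _ | m
  · simp
  rw [Nat.add_sub_cancel, ← sum_Icc_two_inv_sub_one]
  refine Finset.sum_congr rfl fun d hd => ?_
  have hd' : (2 : ℝ) ≤ d := by exact_mod_cast (Finset.mem_Icc.1 hd).1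
  have h1 : (d : ℝ) - 1 ≠ 0 := by linarith
  rw [truncDigit_of_mem hd]
  field_simp

theorem integral_truncDigit_sq_le (m k : ℕ) :
    ∫ x, truncDigit m (lurothDigit k x) ^ 2 ∂unitLebesgue ≤ 2 * m := by
  rw [integral_comp_lurothDigit k m (fun d => truncDigit m d ^ 2)
    fun d hd => by simp [truncDigit_of_notMem hd]]
  calc ∑ d ∈ Finset.Icc 2 m, truncDigit m d ^ 2 / ((d : ℝ) * (d - 1))
      ≤ ∑ d ∈ Finset.Icc 2 m, (2 : ℝ) := by
        refine Finset.sum_le_sum fun d hd => ?_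
        have hd' : (2 : ℝ) ≤ d := by exact_mod_cast (Finset.mem_Icc.1 hd).1
        rw [truncDigit_of_mem hd, div_le_iff₀ (mul_pos (by linarith) (by linarith))]
        nlinarith
    _ = 2 * ((m + 1 - 2 : ℕ) : ℝ) := by simp [mul_comm]
    _ ≤ 2 * m := by gcongr; lia

theorem memLp_truncDigit (m k : ℕ) :
    MemLp (fun x => truncDigit m (lurothDigit k x)) 2 unitLebesgue :=
  MemLp.of_bound (measurable_truncDigit_comp m k).aestronglyMeasurable m
    (ae_of_all _ fun _ => abs_truncDigit_le _ _)

theorem variance_truncDigit_le (m k : ℕ) :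
    Var[fun x => truncDigit m (lurothDigit k x); unitLebesgue] ≤ 2 * m :=
  (variance_le_expectation_sq (measurable_truncDigit_comp m k).aestronglyMeasurable).trans
    (integral_truncDigit_sq_le m k)

/-- With `⌊r⌋₊ = e + 1`, the harmonic number lies between `log (e + 1)` and `1 + log e`, while `r <
e + 2 ≤ 2 (e + 1)` costs only `log 2 < 1`. -/
theorem abs_harmonic_floor_sub_log_le {r : ℝ} (hr : 1 ≤ r) :
    |(harmonic (⌊r⌋₊ - 1) : ℝ) - Real.log r| ≤ 1 := by
  have hm : 1 ≤ ⌊r⌋₊ := Nat.le_floor (by simpa using hr)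
  obtain ⟨e, he⟩ : ∃ e, ⌊r⌋₊ = e + 1 := ⟨⌊r⌋₊ - 1, by lia⟩
  rw [he, Nat.add_sub_cancel]
  have h1 := log_add_one_le_harmonic e
  have h2 := harmonic_le_one_add_log e
  have h3 : ((e : ℝ) + 1) ≤ r := by
    have := Nat.floor_le (zero_le_one.trans hr); rw [he] at this; exact_mod_cast this
  have h4 : r < (e : ℝ) + 1 + 1 := by
    have := Nat.lt_floor_add_one r; rw [he] at this; exact_mod_cast this
  have he0 : (0 : ℝ) ≤ e := e.cast_nonneg
  -- The case `e = 0` rests on the convention `log 0 = 0`.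
  have h5 : Real.log e ≤ Real.log r := by
    rcases Nat.eq_zero_or_pos e with h | h
    · simpa [h] using Real.log_nonneg hr
    · exact Real.log_le_log (by exact_mod_cast h) (by linarith)
  have h6 : Real.log r ≤ Real.log 2 + Real.log (e + 1) := by
    rw [← Real.log_mul (by norm_num) (by linarith)]
    exact Real.log_le_log (by linarith) (by linarith)
  have h7 := Real.log_two_lt_d9
  push_cast at h1
  rw [abs_le]
  constructor <;> linarith

/-! ### Concentration of convex combinations of digits. -/

section Weighted

variable {n : ℕ} {a : ℕ → ℝ} {b : ℝ}

theorem abs_integral_sum_truncDigit_sub_le (ha : ∀ k ∈ Finset.Icc 1 n, 0 < a k)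
    (ha1 : ∀ k ∈ Finset.Icc 1 n, a k ≤ 1) (hsum : ∑ k ∈ Finset.Icc 1 n, a k = 1) (hb : 1 ≤ b) :
    |∫ x, (∑ k ∈ Finset.Icc 1 n, fun x => a k * truncDigit ⌊b / a k⌋₊ (lurothDigit k x)) x
        ∂unitLebesgue - (Real.log b - ∑ k ∈ Finset.Icc 1 n, a k * Real.log (a k))| ≤ 1 := by
  simp only [Finset.sum_apply]
  rw [integral_finsetSum _ fun k _ =>
    ((memLp_truncDigit ⌊b / a k⌋₊ k).integrable one_le_two).const_mul (a k)]
  simp only [integral_const_mul, integral_truncDigit]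
  have h : Real.log b = ∑ k ∈ Finset.Icc 1 n, a k * Real.log b := by
    rw [← Finset.sum_mul, hsum, one_mul]
  rw [h, ← Finset.sum_sub_distrib, ← Finset.sum_sub_distrib]
  calc _ ≤ ∑ k ∈ Finset.Icc 1 n, |a k * (harmonic (⌊b / a k⌋₊ - 1) : ℝ) -
          (a k * Real.log b - a k * Real.log (a k))| := Finset.abs_sum_le_sum_abs _ _
    _ ≤ ∑ k ∈ Finset.Icc 1 n, a k := by
      refine Finset.sum_le_sum fun k hk => ?_
      rw [← mul_sub, ← Real.log_div (by linarith) (ha k hk).ne', ← mul_sub, abs_mul,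
        abs_of_pos (ha k hk)]
      refine mul_le_of_le_one_right (ha k hk).le (abs_harmonic_floor_sub_log_le ?_)
      rw [le_div_iff₀ (ha k hk)]
      linarith [ha1 k hk]
    _ = 1 := hsum

theorem memLp_sum_truncDigit : MemLp (∑ k ∈ Finset.Icc 1 n,
    fun x => a k * truncDigit ⌊b / a k⌋₊ (lurothDigit k x)) 2 unitLebesgue :=
  memLp_finsetSum' _ fun k _ => (memLp_truncDigit _ k).const_mul (a k)

/-- The level `b / a k` turns `a k ^ 2` times a second moment of order `b / a k` into a term linear
in `a k`, and the weights sum to `1`. -/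
theorem variance_sum_truncDigit_le (ha : ∀ k ∈ Finset.Icc 1 n, 0 < a k)
    (hsum : ∑ k ∈ Finset.Icc 1 n, a k = 1) (hb : 0 ≤ b) :
    Var[∑ k ∈ Finset.Icc 1 n, fun x => a k * truncDigit ⌊b / a k⌋₊ (lurothDigit k x);
      unitLebesgue] ≤ 2 * b := by
  rw [IndepFun.variance_sum (fun k _ => (memLp_truncDigit _ k).const_mul (a k))]
  · calc _ ≤ ∑ k ∈ Finset.Icc 1 n, a k * (2 * b) := by
          refine Finset.sum_le_sum fun k hk => ?_
          have hk0 := ha k hk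
          rw [variance_const_mul]
          calc _ ≤ a k ^ 2 * (2 * (b / a k)) := by
                gcongr
                refine (variance_truncDigit_le _ k).trans ?_
                gcongr
                exact Nat.floor_le (by positivity)
            _ = a k * (2 * b) := by field_simp
      _ = 2 * b := by rw [← Finset.sum_mul, hsum, one_mul]
  · intro i hi j hj hij
    exact (indepFun_lurothDigit (Finset.mem_Icc.1 hi).1 (Finset.mem_Icc.1 hj).1 hij).comp
      (measurable_from_top (f := fun d => a i * truncDigit ⌊b / a i⌋₊ d))
      (measurable_from_top (f := fun d => a j * truncDigit ⌊b / a j⌋₊ d))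

theorem ae_two_le_lurothDigit (k : ℕ) : ∀ᵐ x ∂unitLebesgue, 2 ≤ lurothDigit k x :=
  (measurePreserving_lurothMap.iterate (k - 1)).quasiMeasurePreserving.ae
    (ae_mem_Ioc_unitLebesgue.mono fun _ hx => two_le_lurothFirst hx)

/-- Concentration of a convex combination of Lüroth digits around `log b` plus the entropy of the
weights, where `b` is the truncation level. -/
theorem unitLebesgue_weighted_sum_deviation_le (ha : ∀ k ∈ Finset.Icc 1 n, 0 < a k)
    (hsum : ∑ k ∈ Finset.Icc 1 n, a k = 1) (hb : 2 ≤ b) {δ : ℝ} (hδ : 1 < δ) :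
    unitLebesgue {x | δ ≤ |∑ k ∈ Finset.Icc 1 n, a k * (lurothDigit k x : ℝ) -
        (Real.log b - ∑ k ∈ Finset.Icc 1 n, a k * Real.log (a k))|} ≤
      ENNReal.ofReal (2 / b) + ENNReal.ofReal (2 * b / (δ - 1) ^ 2) := by
  have ha1 : ∀ k ∈ Finset.Icc 1 n, a k ≤ 1 := fun k hk =>
    hsum ▸ Finset.single_le_sum (fun i hi => (ha i hi).le) hk
  set X := ∑ k ∈ Finset.Icc 1 n, fun x => a k * truncDigit ⌊b / a k⌋₊ (lurothDigit k x) with hX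
  have hmean := abs_integral_sum_truncDigit_sub_le ha ha1 hsum (by linarith : 1 ≤ b)
  rw [← hX] at hmean
  -- The lost `1` in `δ - 1` pays for the error in the mean.
  have hcheb : unitLebesgue {x | δ - 1 ≤ |X x - ∫ y, X y ∂unitLebesgue|} ≤
      ENNReal.ofReal (2 * b / (δ - 1) ^ 2) := by
    refine (meas_ge_le_variance_div_sq memLp_sum_truncDigit (by linarith)).trans ?_
    gcongr
    exact variance_sum_truncDigit_le ha hsum (by linarith)
  have hexc : unitLebesgue (⋃ k ∈ Finset.Icc 1 n, {x | b / a k < lurothDigit k x}) ≤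
      ENNReal.ofReal (2 / b) := by
    calc _ ≤ ∑ k ∈ Finset.Icc 1 n, unitLebesgue {x | b / a k < lurothDigit k x} :=
          measure_biUnion_finset_le _ _
      _ ≤ ∑ k ∈ Finset.Icc 1 n, ENNReal.ofReal (2 / (b / a k)) := by
          refine Finset.sum_le_sum fun k hk => unitLebesgue_lt_lurothDigit_le k ?_
          rw [le_div_iff₀ (ha k hk)]
          nlinarith [ha1 k hk]
      _ = ENNReal.ofReal (∑ k ∈ Finset.Icc 1 n, 2 / (b / a k)) := by
          refine (ENNReal.ofReal_sum_of_nonneg fun k hk => ?_).symm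
          have := ha k hk
          positivity
      _ = ENNReal.ofReal (2 / b) := by
          congr 1
          rw [← mul_one (2 / b), ← hsum, Finset.mul_sum]
          refine Finset.sum_congr rfl fun k hk => ?_
          have := (ha k hk).ne'
          field_simp
  refine (measure_mono_ae ?_).trans ((measure_union_le _ _).trans (add_le_add hexc hcheb))
  filter_upwards [ae_all_iff.2 ae_two_le_lurothDigit] with x hx2 hx
  by_cases h : x ∈ ⋃ k ∈ Finset.Icc 1 n, {x | b / a k < lurothDigit k x}
  · exact Or.inl h
  · refine Or.inr ?_
    simp only [Set.mem_iUnion, Set.mem_ofPred_eq, not_exists, not_lt] at h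
    have hXx : X x = ∑ k ∈ Finset.Icc 1 n, a k * (lurothDigit k x : ℝ) := by
      rw [hX, Finset.sum_apply]
      refine Finset.sum_congr rfl fun k hk => ?_
      rw [truncDigit_of_mem (Finset.mem_Icc.2 ⟨hx2 k, Nat.le_floor (h k hk)⟩)]
    have hx' : δ ≤ |X x - (Real.log b - ∑ k ∈ Finset.Icc 1 n, a k * Real.log (a k))| := by
      rw [hXx]; exact hx
    have := abs_sub_le (X x) (∫ y, X y ∂unitLebesgue)
      (Real.log b - ∑ k ∈ Finset.Icc 1 n, a k * Real.log (a k))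
    show δ - 1 ≤ _
    linarith

end Weighted

/-! ### Slopes of the distribution functions and the conclusion. -/

theorem GeneratesLuroth.apply_one_div {F : ℕ → ℝ → ℝ} (hL : GeneratesLuroth F) {n : ℕ}
    (hn : 1 ≤ n) (h1 : F n 1 = 1) (h : ℕ) : F n (1 / ((h : ℝ) + 1)) = 1 / ((h : ℝ) + 1) := by
  induction h with
  | zero => simpa using h1
  | succ h ih =>
    have := hL n (h + 1) hn (by lia)
    push_cast at this ⊢
    rw [ih] at this
    have e : 1 / ((h : ℝ) + 1 + 1) = 1 / (h + 1) - 1 / ((h + 1) * (h + 1 + 1)) := by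
      field_simp; ring
    linarith

/-- Distribution functions generating the Lüroth digits have slope `1` at `0`. -/
theorem GeneratesLuroth.slope_eq_one {F : ℕ → ℝ → ℝ} {c : ℕ → ℝ} (hL : GeneratesLuroth F)
    (hF : ∀ n, 1 ≤ n → IsUnitDistFun (F n)) (hi : UniformSlope F c) {n : ℕ} (hn : 1 ≤ n) :
    c n = 1 := by
  -- Along `t = 1 / (h + 1)` the quotient `F n t / t` is exactly `1`, so `|1 - c n|` is below a
  -- supremum tending to `0`.
  have hseq : Tendsto (fun h : ℕ => 1 / ((h : ℝ) + 1)) atTop (𝓝[>] 0) :=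
    tendsto_nhdsWithin_iff.2 ⟨tendsto_one_div_add_atTop_nhds_zero_nat,
      Eventually.of_forall fun h => by simp only [Set.mem_Ioi]; positivity⟩
  have hle : ENNReal.ofReal |1 - c n| ≤ 0 := by
    refine ge_of_tendsto' (hi.tendsto_sup.comp hseq) fun h => ?_
    refine le_trans (le_of_eq ?_) (le_iSup₂ (f := fun m (_ : m ∈ Set.Ici 1) =>
      ENNReal.ofReal |F m (1 / ((h : ℝ) + 1)) / (1 / ((h : ℝ) + 1)) - c m|) n hn)
    rw [hL.apply_one_div hn (hF n hn).at_one, div_self (by positivity)]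
  have := abs_nonpos_iff.1 (ENNReal.ofReal_eq_zero.1 (nonpos_iff_eq_zero.1 hle))
  linarith

theorem lurothMean_one (α : ℝ) (n : ℕ) (x : ℝ) : lurothMean α 1 n x =
    ∑ k ∈ Finset.Icc 1 n, meanWeight α k / meanTotal α n * (lurothDigit k x : ℝ) := by
  simp only [lurothMean, iteratedMean, Finset.sum_div]
  exact Finset.sum_congr rfl fun k _ => by ring

theorem meanWeight_pos (α : ℝ) {k : ℕ} (hk : 1 ≤ k) : 0 < meanWeight α k := by
  have : (0 : ℝ) < k := by exact_mod_cast hk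
  unfold meanWeight
  positivity

theorem meanTotal_pos (α : ℝ) {n : ℕ} (hn : 1 ≤ n) : 0 < meanTotal α n :=
  Finset.sum_pos (fun _ hk => meanWeight_pos α (Finset.mem_Icc.1 hk).1) ⟨1, by simp [hn]⟩

theorem mainTheorem11 (α : ℝ) (hα : α < 1)
    (F : ℕ → ℝ → ℝ) (c : ℕ → ℝ) (ρ : ℕ → ℝ) (ℓ : ℝ)
    (hF : ∀ n, 1 ≤ n → IsUnitDistFun (F n))
    (hi : UniformSlope F c)
    (hii : UniformSlopeIntegrable F c)
    (hL : GeneratesLuroth F)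
    (ha : ArrayConditions c (fun k n => meanWeight α k / meanTotal α n) ρ ℓ) :
    TendstoInMeasure unitLebesgue
      (fun (n : ℕ) (x : ℝ) => 1 / (ρ n * Real.log n) * lurothMean α 1 n x)
      atTop (fun _ => ℓ) := by
  set b : ℕ → ℝ := fun n => ρ n * Real.log n with hbdef
  have hb : Tendsto b atTop atTop := ha.norm_tendsto
  set H : ℕ → ℝ := fun n => ∑ k ∈ Finset.Icc 1 n,
    meanWeight α k / meanTotal α n * Real.log (meanWeight α k / meanTotal α n) with hHdef
  have hH : Tendsto (fun n => H n / b n) atTop (𝓝 (-ℓ)) := by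
    refine ha.tendsto_neg.congr fun n => ?_
    congr 1
    refine Finset.sum_congr rfl fun k hk => ?_
    rw [hL.slope_eq_one hF hi (Finset.mem_Icc.1 hk).1, one_mul]
  have hcenter : Tendsto (fun n => (Real.log (b n) - H n) / b n) atTop (𝓝 ℓ) := by
    have hlog : Tendsto (fun n => Real.log (b n) / b n) atTop (𝓝 0) :=
      Real.isLittleO_log_id_atTop.tendsto_div_nhds_zero.comp hb
    simpa [sub_div] using hlog.sub hH
  rw [tendstoInMeasure_iff_dist]
  intro ε hε
  -- The `32` arises from `b ε / 2 - 1 ≥ b ε / 4`, valid once `b ≥ 4 / ε`: then `2b / (b ε / 4)^2 =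
  -- 32 / (ε^2 b)`.
  have hbound : Tendsto (fun n => ENNReal.ofReal (2 / b n) + ENNReal.ofReal (32 / ε ^ 2 / b n))
      atTop (𝓝 0) := by
    have h (r : ℝ) : Tendsto (fun n => ENNReal.ofReal (r / b n)) atTop (𝓝 0) := by
      simpa using ENNReal.tendsto_ofReal (hb.const_div_atTop r)
    simpa using (h 2).add (h (32 / ε ^ 2))
  refine tendsto_of_tendsto_of_tendsto_of_le_of_le' tendsto_const_nhds hbound
    (Eventually.of_forall fun _ => zero_le) ?_
  filter_upwards [hb.eventually_ge_atTop 2, hb.eventually_ge_atTop (4 / ε), eventually_ge_atTop 1,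
    Metric.tendsto_nhds.1 hcenter (ε / 2) (by positivity)] with n h2 h4 hn hc
  have hb0 : 0 < b n := by linarith
  rw [div_le_iff₀ hε] at h4
  -- The truncation level is the normalisation itself; half of `ε` is reserved for the convergence
  -- of the centre.
  have hdev := unitLebesgue_weighted_sum_deviation_le (n := n)
    (a := fun k => meanWeight α k / meanTotal α n)
    (fun k hk => div_pos (meanWeight_pos α (Finset.mem_Icc.1 hk).1) (meanTotal_pos α hn))
    (by rw [← Finset.sum_div]; exact div_self (meanTotal_pos α hn).ne') h2
    (δ := b n * ε / 2) (by linarith)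
  refine (measure_mono fun x hx => ?_).trans (hdev.trans (add_le_add le_rfl
    (ENNReal.ofReal_le_ofReal ?_)))
  · have hx' : ε ≤ |1 / b n * lurothMean α 1 n x - ℓ| := hx
    have htri := abs_sub_le (1 / b n * lurothMean α 1 n x) ((Real.log (b n) - H n) / b n) ℓ
    rw [Real.dist_eq] at hc
    have h : ε / 2 ≤ |1 / b n * lurothMean α 1 n x - (Real.log (b n) - H n) / b n| := by linarith
    rw [one_div_mul_eq_div, ← sub_div, abs_div, abs_of_pos hb0, le_div_iff₀ hb0,
      lurothMean_one] at h
    show b n * ε / 2 ≤ _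
    linarith
  · calc 2 * b n / (b n * ε / 2 - 1) ^ 2 ≤ 2 * b n / (b n * ε / 4) ^ 2 := by
          gcongr
          linarith
      _ = 32 / ε ^ 2 / b n := by field_simp; norm_num
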